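/- Let $N\ge 3$, $r,s\ge 1$ be integers, let $0<p_m<1$ for $m=0,1,2,3$, and put $q_m:=1-p_m$. Let $\Sigma:=\{0,1\}^N$. For $\mathbf x\in\Sigma$ and $i\in\{1,\dots,N\}$ (indices modulo $N$) let $m_i(\mathbf x):=2x_{i-1}+x_{i+1}$, and let $\mathbf x^i$ be $\mathbf x$ with the $i$th coordinate $x_i$ replaced by $1-x_i$. Let $\mathbf P_B$ be the matrix on $\Sigma$ with $$P_B(\mathbf x,\mathbf x^i)=\begin{cases}N^{-1}p_{m_i(\mathbf x)}&x_i=0\\ N^{-1}q_{m_i(\mathbf x)}&x_i=1\end{cases},\qquad P_B(\mathbf x,\mathbf x)=N^{-1}\Big(\sum_{i:x_i=0}q_{m_i(\mathbf x)}+\sum_{i:x_i=1}p_{m_i(\mathbf x)}\Big),$$ and all other entries $0$; let $\mathbf P_A$ be $\mathbf P_B$ with $p_0=p_1=p_2=p_3=\tfrac12$, and let $\dot{\mathbf P}_B$ be obtained from $\mathbf P_B$ by replacing each $q_m$ in these formulas by $-q_m$. Let $\Sigma^*:=\Sigma\times\{1,\dots,N\}$, and let $\mathbf P_B^*$ be the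 transition matrix on $\Sigma^*$ with, for all $j\in\{1,\dots,N\}$, $$P_B^*((\mathbf x,i),(\mathbf x^i,j))=\begin{cases}N^{-1}p_{m_i(\mathbf x)}&x_i=0\\ N^{-1}q_{m_i(\mathbf x)}&x_i=1\end{cases},\qquad P_B^*((\mathbf x,i),(\mathbf x,j))=\begin{cases}N^{-1}q_{m_i(\mathbf x)}&x_i=0\\ N^{-1}p_{m_i(\mathbf x)}&x_i=1\end{cases},$$ and all other entries $0$; let $\mathbf P_A^*$ be $\mathbf P_B^*$ with all $p_m=\tfrac12$. Let the payoff $w((\mathbf x,i),(\mathbf y,j))$ be $1$ (a win), $-1$ (a loss) or $0$ according to whether the corresponding entry of $\mathbf P_B^*$ above is of the form $N^{-1}p_m$, of the form $N^{-1}q_m$, or one of the other, zero, entries. Let $G$ be the group of rotations of $\{1,\dots,N\}$ or, if $p_1=p_2$, possibly instead the dihedral group generated by the rotations and the order reversal. Write $\mathbf x\sim\mathbf y$ if $\mathbf y=(x_{\sigma(1)},\dots,x_{\sigma(N)})$ for some $\sigma\in G$. For $\mathbf Q\in\{\mathbf P_A,\mathbf P_B,\dot{\mathbf P}_B\}$ let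 $\bar{\mathbf Q}$ be the matrix on $\Sigma/{\sim}$ given by $\bar Q([\mathbf x],[\mathbf y]):=\sum_{\mathbf y'\sim\mathbf y}Q(\mathbf x,\mathbf y')$ (this does not depend on the choice of the representative $\mathbf x$), and write $\dot{\bar{\mathbf P}}_B$ for the matrix so obtained from $\dot{\mathbf P}_B$. Then $\bar{\mathbf P}_A^r\bar{\mathbf P}_B^s$ has a unique stationary distribution $\bar{\boldsymbol\pi}$ (a row vector). Moreover, let $\{(\mathbf X(n),I(n))\}_{n\ge0}$ be any nonhomogeneous Markov chain in $\Sigma^*$, with arbitrary initial distribution, whose successive one-step transition matrices are $\mathbf P_A^*$ ($r$ times), $\mathbf P_B^*$ ($s$ times), $\mathbf P_A^*$ ($r$ times), $\mathbf P_B^*$ ($s$ times), and so on. Put $\xi_n:=w\big((\mathbf X(n-1),I(n-1)),(\mathbf X(n),I(n))\big)$ and $S_n:=\xi_1+\cdots+\xi_n$ for $n\ge1$. Then, almost surely, $$\lim_{n\to\infty}n^{-1}S_n=\mu_{[r,s]}:=\frac1{r+s}\sum_{v=0}^{s-1}\bar{\boldsymbol\pi}\,\bar{\mathbf P}_A^r\,\bar{\mathbf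 P}_B^v\,\dot{\bar{\mathbf P}}_B\,\mathbf 1,$$ where $\mathbf 1$ is the column vector of $1$s indexed by $\Sigma/{\sim}$. -/

import Mathlib

open scoped Matrix Topology
open MeasureTheory Filter

namespace Toral

/-! ### Configurations of the `N` players -/

/-- The set `Σ = {0,1}^N` of configurations: `x i = true` (that is, `1`) if player `i` is a winner,
`x i = false` (that is, `0`) if player `i` is a loser. -/
abbrev Config (N : ℕ) : Type := Fin N → Bool

/-- The neighbour `i + 1` of player `i` on the circle. -/
def next {N : ℕ} (i : Fin N) : Fin N := finRotate N i

/-- The neighbour `i - 1` of player `i` on the circle. -/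
def prev {N : ℕ} (i : Fin N) : Fin N := (finRotate N).symm i

/-- `m_i(x) = 2 x_{i-1} + x_{i+1}`, an element of `{0,1,2,3}`. -/
def nbr {N : ℕ} (x : Config N) (i : Fin N) : Fin 4 :=
  ⟨2 * (x (prev i)).toNat + (x (next i)).toNat, by
    have h1 := Bool.toNat_le (x (prev i))
    have h2 := Bool.toNat_le (x (next i))
    omega⟩

/-- `x^i`: the configuration `x` with the `i`-th entry flipped. -/
def flip {N : ℕ} (x : Config N) (i : Fin N) : Config N := Function.update x i (!x i)

/-! ### The chain on `Σ` -/

/-- The matrix on `Σ` in which `p` and `q` are two unrelated coefficient vectors.  Its entry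
at `(x, x^i)` is `N⁻¹ p_{m_i(x)}` if `x_i = 0` and `N⁻¹ q_{m_i(x)}` if `x_i = 1`; its entry at
`(x, x)` is `N⁻¹ (∑_{i : x_i = 0} q_{m_i(x)} + ∑_{i : x_i = 1} p_{m_i(x)})`; all others are `0`.
(The configurations `x, x^1, …, x^N` are distinct, so at most one term below is nonzero.) -/
noncomputable def formMatrix (N : ℕ) (p q : Fin 4 → ℝ) : Matrix (Config N) (Config N) ℝ :=
  fun x y =>
    (∑ i : Fin N, if y = flip x i then
        (N : ℝ)⁻¹ * (if x i = false then p (nbr x i) else q (nbr x i)) else 0)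
    + (if y = x then
        (N : ℝ)⁻¹ * ((∑ i : Fin N with x i = false, q (nbr x i))
          + ∑ i : Fin N with x i = true, p (nbr x i)) else 0)

/-- The one-step transition matrix `P_B` with `q_m = 1 - p_m`. -/
noncomputable def matB (N : ℕ) (p : Fin 4 → ℝ) : Matrix (Config N) (Config N) ℝ :=
  formMatrix N p (fun m => 1 - p m)

/-- `P_A`: the matrix `P_B` with `p_0 = p_1 = p_2 = p_3 = 1/2`. -/
noncomputable def matA (N : ℕ) : Matrix (Config N) (Config N) ℝ := matB N (fun _ => 1 / 2)

/-- `Ṗ_B`: the matrix `P_B` with each `q_m` replaced by `-q_m`. -/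
noncomputable def matBdot (N : ℕ) (p : Fin 4 → ℝ) : Matrix (Config N) (Config N) ℝ :=
  formMatrix N p (fun m => -(1 - p m))

/-! ### Symmetries and the reduced matrices -/

/-- The group of rotations of the players. -/
def rotationGroup (N : ℕ) : Subgroup (Equiv.Perm (Fin N)) := Subgroup.zpowers (finRotate N)

/-- The dihedral group, generated by the rotations and the order-reversing permutation. -/
def dihedralGroup (N : ℕ) : Subgroup (Equiv.Perm (Fin N)) :=
  Subgroup.closure {finRotate N, Fin.revPerm}

/-- `x ∼ y` if `y = x_σ` for some `σ ∈ G`, where `x_σ = (x_{σ(1)}, …, x_{σ(N)})`. -/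
def equivSetoid {N : ℕ} (G : Subgroup (Equiv.Perm (Fin N))) : Setoid (Config N) where
  r x y := ∃ σ ∈ G, y = x ∘ σ
  iseqv :=
    { refl := fun _ => ⟨1, G.one_mem, rfl⟩
      symm := by
        rintro x _ ⟨σ, hσ, rfl⟩
        exact ⟨σ⁻¹, G.inv_mem hσ, by funext i; simp⟩
      trans := by
        rintro x _ _ ⟨σ, hσ, rfl⟩ ⟨τ, hτ, rfl⟩
        exact ⟨σ * τ, G.mul_mem hσ hτ, rfl⟩ }

/-- The quotient set `Σ/∼`. -/
def Classes {N : ℕ} (G : Subgroup (Equiv.Perm (Fin N))) : Type := Quotient (equivSetoid G)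

/-- The equivalence class `[x]`. -/
def cls {N : ℕ} (G : Subgroup (Equiv.Perm (Fin N))) (x : Config N) : Classes G :=
  Quotient.mk (equivSetoid G) x

/-- A representative of an equivalence class. -/
noncomputable def rep {N : ℕ} {G : Subgroup (Equiv.Perm (Fin N))} (a : Classes G) : Config N :=
  Quotient.out a

theorem cls_rep {N : ℕ} {G : Subgroup (Equiv.Perm (Fin N))} (a : Classes G) :
    cls G (rep a) = a := Quotient.out_eq a

theorem cls_eq_iff {N : ℕ} {G : Subgroup (Equiv.Perm (Fin N))} {x y : Config N} :
    cls G x = cls G y ↔ ∃ σ ∈ G, y = x ∘ σ :=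
  ⟨fun h => Quotient.exact h, fun h => Quotient.sound h⟩

noncomputable instance {N : ℕ} (G : Subgroup (Equiv.Perm (Fin N))) : DecidableEq (Classes G) :=
  Classical.decEq _

noncomputable instance {N : ℕ} (G : Subgroup (Equiv.Perm (Fin N))) : Fintype (Classes G) :=
  Fintype.ofSurjective (cls G) (fun a => ⟨rep a, cls_rep a⟩)

/-- `P` is `G`-invariant if `P(x_σ, y_σ) = P(x, y)` for all `σ ∈ G`. -/
def IsInvariant {N : ℕ} (G : Subgroup (Equiv.Perm (Fin N)))
    (P : Matrix (Config N) (Config N) ℝ) : Prop :=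
  ∀ σ ∈ G, ∀ x y : Config N, P (x ∘ σ) (y ∘ σ) = P x y

/-- The reduced matrix `P̄([x], [y]) = ∑_{y' ∼ y} P(x, y')`.  For `G`-invariant `P` it does
not depend on the representative `x`, see `reduce_cls`. -/
noncomputable def reduce {N : ℕ} (G : Subgroup (Equiv.Perm (Fin N)))
    (P : Matrix (Config N) (Config N) ℝ) : Matrix (Classes G) (Classes G) ℝ :=
  fun a b => ∑ y : Config N with cls G y = b, P (rep a) y

theorem reduce_cls {N : ℕ} {G : Subgroup (Equiv.Perm (Fin N))}
    {P : Matrix (Config N) (Config N) ℝ} (hP : IsInvariant G P) (x y : Config N) :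
    reduce G P (cls G x) (cls G y) = ∑ y' : Config N with cls G y' = cls G y, P x y' := by
  obtain ⟨σ, hσ, h⟩ := cls_eq_iff.1 (cls_rep (cls G x))
  unfold reduce
  refine Finset.sum_equiv (σ.arrowCongr (Equiv.refl Bool)).symm ?_ ?_
  · intro z
    have hz : cls G z = cls G ((σ.arrowCongr (Equiv.refl Bool)).symm z) :=
      cls_eq_iff.2 ⟨σ, hσ, by funext i; simp⟩
    simp [hz]
  · intro z _
    have := hP σ hσ (rep (cls G x)) z
    rw [← h] at this
    exact this.symm

/-! The matrices above are invariant under rotations and, if `p_1 = p_2` and `q_1 = q_2`, under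
the dihedral group, so that their reductions are well defined. -/

theorem formMatrix_comp {N : ℕ} {p q : Fin 4 → ℝ} {σ : Equiv.Perm (Fin N)}
    (hp : ∀ (x : Config N) i, p (nbr (x ∘ σ) i) = p (nbr x (σ i)))
    (hq : ∀ (x : Config N) i, q (nbr (x ∘ σ) i) = q (nbr x (σ i))) (x y : Config N) :
    formMatrix N p q (x ∘ σ) (y ∘ σ) = formMatrix N p q x y := by
  have hinj : ∀ u v : Config N, u ∘ σ = v ∘ σ ↔ u = v := fun u v =>
    σ.surjective.injective_comp_right.eq_iff
  have hflip : ∀ i, flip (x ∘ σ) i = flip x (σ i) ∘ σ := by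
    intro i
    funext j
    simp [flip, Function.update_apply]
  unfold formMatrix
  congr 1
  · refine Fintype.sum_equiv σ _ _ fun i => ?_
    simp only [hflip, hinj, hp, hq, Function.comp_apply]
  · simp only [hinj, hp, hq, Function.comp_apply, Finset.sum_filter]
    rw [Equiv.sum_comp σ (fun i => if x i = false then q (nbr x i) else 0),
      Equiv.sum_comp σ (fun i => if x i = true then p (nbr x i) else 0)]

theorem nbr_rotate {N : ℕ} (x : Config N) (i : Fin N) :
    nbr (x ∘ finRotate N) i = nbr x (finRotate N i) := by
  simp only [nbr, next, prev, Function.comp_apply, Equiv.apply_symm_apply,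
    Equiv.symm_apply_apply]

theorem rev_next {N : ℕ} (i : Fin N) : Fin.rev (next i) = prev (Fin.rev i) := by
  unfold next prev
  rw [Equiv.eq_symm_apply]
  cases N with
  | zero => exact i.elim0
  | succ n =>
    simp only [finRotate_apply]
    have h := Fin.rev_sub i.rev 1
    simp only [Fin.rev_rev] at h
    rw [← h]
    simp

theorem rev_prev {N : ℕ} (i : Fin N) : Fin.rev (prev i) = next (Fin.rev i) := by
  have h := rev_next (Fin.rev i)
  rw [Fin.rev_rev] at h
  rw [← h, Fin.rev_rev]

theorem apply_nbr_rev {N : ℕ} {p : Fin 4 → ℝ} (h : p 1 = p 2) (x : Config N) (i : Fin N) :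
    p (nbr (x ∘ Fin.revPerm) i) = p (nbr x (Fin.revPerm i)) := by
  simp only [nbr, Function.comp_apply, Fin.revPerm_apply, rev_next, rev_prev]
  have key : ∀ a b : Bool, ∀ h1 h2, p ⟨2 * a.toNat + b.toNat, h1⟩ = p ⟨2 * b.toNat + a.toNat, h2⟩ := by
    intro a b _ _
    cases a <;> cases b <;> first | rfl | exact h | exact h.symm
  exact key _ _ _ _

theorem isInvariant_closure {N : ℕ} {P : Matrix (Config N) (Config N) ℝ}
    {S : Set (Equiv.Perm (Fin N))}
    (h : ∀ σ ∈ S, ∀ x y : Config N, P (x ∘ σ) (y ∘ σ) = P x y) :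
    IsInvariant (Subgroup.closure S) P := by
  intro σ hσ
  induction hσ using Subgroup.closure_induction with
  | mem σ hσ => exact h σ hσ
  | one => intro x y; rfl
  | mul σ τ _ _ h1 h2 => intro x y; exact (h2 (x ∘ σ) (y ∘ σ)).trans (h1 x y)
  | inv σ _ h1 =>
    intro x y
    rw [← h1 (x ∘ (σ⁻¹ : Equiv.Perm (Fin N)))]
    congr 1 <;> funext i <;> simp

theorem isInvariant_rotationGroup (N : ℕ) (p q : Fin 4 → ℝ) :
    IsInvariant (rotationGroup N) (formMatrix N p q) := by
  unfold rotationGroup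
  rw [Subgroup.zpowers_eq_closure]
  refine isInvariant_closure ?_
  rintro σ rfl
  exact formMatrix_comp (fun x i => by rw [nbr_rotate]) (fun x i => by rw [nbr_rotate])

theorem isInvariant_dihedralGroup (N : ℕ) {p q : Fin 4 → ℝ} (hp : p 1 = p 2) (hq : q 1 = q 2) :
    IsInvariant (dihedralGroup N) (formMatrix N p q) := by
  refine isInvariant_closure ?_
  rintro σ (rfl | rfl)
  · exact formMatrix_comp (fun x i => by rw [nbr_rotate]) (fun x i => by rw [nbr_rotate])
  · exact formMatrix_comp (apply_nbr_rev hp) (apply_nbr_rev hq)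

/-- `π` is a stationary distribution of the matrix `P`: a probability vector with `π P = π`. -/
def IsStationary {ι : Type*} [Fintype ι] (P : Matrix ι ι ℝ) (π : ι → ℝ) : Prop :=
  π ∈ stdSimplex ℝ ι ∧ π ᵥ* P = π

/-- `(1/(r+s)) ∑_{v=0}^{s-1} π̄ P̄_A^r P̄_B^v (Ṗ̄_B) 1` for a row vector `π̄` indexed by `Σ/∼`. -/
noncomputable def reducedMean {N : ℕ} (G : Subgroup (Equiv.Perm (Fin N))) (p : Fin 4 → ℝ)
    (r s : ℕ) (π : Classes G → ℝ) : ℝ :=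
  1 / ((r : ℝ) + s) * ∑ v ∈ Finset.range s,
    (π ᵥ* (reduce G (matA N) ^ r * reduce G (matB N p) ^ v * reduce G (matBdot N p)))
      ⬝ᵥ (fun _ => 1)

/-! ### The chain augmented by the label of the next player -/

/-- `P_B^*` on `Σ^* = Σ × {1,…,N}`: player `i` plays, and the next player `j` is uniform. -/
noncomputable def starB (N : ℕ) (p : Fin 4 → ℝ) :
    Matrix (Config N × Fin N) (Config N × Fin N) ℝ :=
  fun a b =>
    let x := a.1
    let i := a.2
    let y := b.1
    if y = flip x i then
      (N : ℝ)⁻¹ * (if x i = false then p (nbr x i) else 1 - p (nbr x i))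
    else if y = x then
      (N : ℝ)⁻¹ * (if x i = false then 1 - p (nbr x i) else p (nbr x i))
    else 0

/-- `P_A^*`: the matrix `P_B^*` with `p_0 = p_1 = p_2 = p_3 = 1/2`. -/
noncomputable def starA (N : ℕ) : Matrix (Config N × Fin N) (Config N × Fin N) ℝ :=
  starB N (fun _ => 1 / 2)

/-- The payoff `w((x,i),(y,j))`: `1` (a win) where the entry of `P_B^*` has the form `N⁻¹ p_m`,
`-1` (a loss) where it has the form `N⁻¹ q_m`, and `0` elsewhere. -/
def payoff {N : ℕ} (a b : Config N × Fin N) : ℝ :=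
  let x := a.1
  let i := a.2
  let y := b.1
  if y = flip x i then (if x i = false then 1 else -1)
  else if y = x then (if x i = false then -1 else 1)
  else 0

/-- The periodic sequence of one-step transition matrices `P_A^*` (`r` times), `P_B^*` (`s` times),
`P_A^*` (`r` times), and so on; the `n`-th one governs the step from time `n` to time `n + 1`. -/
noncomputable def pattern (N : ℕ) (p : Fin 4 → ℝ) (r s : ℕ) (n : ℕ) :
    Matrix (Config N × Fin N) (Config N × Fin N) ℝ :=
  if n % (r + s) < r then starA N else starB N p

/-- `X` is a (nonhomogeneous) Markov chain on the probability space `(Ω, ℙ)` with finite state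
space `ι` whose step from time `n` to time `n + 1` has transition matrix `Q n`.  The initial
distribution is arbitrary. -/
structure IsMarkovChain {Ω ι : Type*} [MeasurableSpace Ω] [MeasurableSpace ι]
    (ℙ : Measure Ω) (Q : ℕ → Matrix ι ι ℝ) (X : ℕ → Ω → ι) : Prop where
  measurable : ∀ n, Measurable (X n)
  step : ∀ (n : ℕ) (z : ℕ → ι),
    ℙ.real {ω | ∀ k ≤ n + 1, X k ω = z k}
      = ℙ.real {ω | ∀ k ≤ n, X k ω = z k} * Q n (z n) (z (n + 1))

/-- The cumulative profit `S_n = ξ_1 + ⋯ + ξ_n`, where `ξ_k = w(X_{k-1}, X_k)`. -/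
def profit {Ω : Type*} {N : ℕ} (X : ℕ → Ω → Config N × Fin N) (n : ℕ) (ω : Ω) : ℝ :=
  ∑ k ∈ Finset.Icc 1 n, payoff (X (k - 1) ω) (X k ω)

end Toral

/-!
The proof solves a Poisson equation and applies a martingale law of large numbers.

The player `I(n)` who acts is uniform and independent of the configurations up to time `n`
(for `n ≥ 1`), and every quantity that enters is invariant under `G`.  Hence the expected profit of
one step is governed by the reduced matrices on `Σ/∼`.  Such a matrix is stochastic, has a positive
diagonal and charges every class reached by changing one player (`reduce_matB_pos`); these
properties pass to the product `R = P̄_A ^ r * P̄_B ^ s`.  Since any two classes are linked by such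
changes, the maximum principle (`eq_of_mulVec_eq_self`) shows that `R h = h` only for constant `h`.
So, with `π` a stationary distribution, `h - R h = F - (π F) 1` can be solved for every `F`
(`exists_sub_mulVec_eq`), and pairing this with a second stationary distribution gives uniqueness.

Take for `F` the expected profit over one period, for which `π F = (r + s) μ`.  The solution `h`
unrolls to a periodic solution of the time-dependent Poisson equation
(`exists_periodic_poisson`), which lifts to a bounded solution `u_n` on `Σ^*` (`starLift`,
`sum_starB_payoff`): the variables `ξ_{n+1} - μ + u_{n+1}(Z_{n+1}) - u_n(Z_n)`, where `Z` is the
augmented chain, are martingale differences.  They are bounded and orthogonal, so their averages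
tend to `0` almost surely (`ae_tendsto_inv_mul_sum_of_integral_sq_le`), and the terms
with `u` telescope to a bounded remainder.
-/

namespace Toral

/-! ### Finite stochastic matrices -/

section Stochastic

variable {ι : Type*} [Fintype ι] {P Q : Matrix ι ι ℝ}

theorem mul_pos_of_pos {adj : ι → ι → Prop} (hrefl : ∀ a, adj a a)
    (hP : ∀ a b, 0 ≤ P a b) (hQ : ∀ a b, 0 ≤ Q a b)
    (hP' : ∀ a b, adj a b → 0 < P a b) (hQ' : ∀ a b, adj a b → 0 < Q a b) (a b : ι)
    (hab : adj a b) : 0 < (P * Q) a b :=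
  Finset.sum_pos' (fun c _ => mul_nonneg (hP a c) (hQ c b))
    ⟨b, Finset.mem_univ b, mul_pos (hP' a b hab) (hQ' b b (hrefl b))⟩

/-- The Poisson equation `h - P h = F - (π F) 1` is solvable: `h ↦ h - P h + (π h) 1` is injective,
hence surjective, and applying `π` to a preimage of `F` identifies the constant. -/
theorem exists_sub_mulVec_eq {π : ι → ℝ}
    (hπ : IsStationary P π) (hh : ∀ h : ι → ℝ, P *ᵥ h = h → ∀ a b, h a = h b) (F : ι → ℝ) :
    ∃ h : ι → ℝ, h = F - (fun _ => π ⬝ᵥ F) + P *ᵥ h := by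
  let one : ι → ℝ := fun _ => 1
  have hπ1 : π ⬝ᵥ one = 1 := by
    simpa [one, dotProduct] using hπ.1.2
  have hπP : ∀ h, π ⬝ᵥ (P *ᵥ h) = π ⬝ᵥ h := fun h => by
    rw [Matrix.dotProduct_mulVec, hπ.2]
  let L : (ι → ℝ) →ₗ[ℝ] (ι → ℝ) :=
    { toFun := fun h => h - P *ᵥ h + (π ⬝ᵥ h) • one
      map_add' := fun f g => by
        rw [Matrix.mulVec_add, dotProduct_add, add_smul]; abel
      map_smul' := fun c f => by
        rw [Matrix.mulVec_smul, dotProduct_smul, RingHom.id_apply, smul_add, smul_sub, smul_smul,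
          smul_eq_mul] }
  have hL : ∀ h, L h = h - P *ᵥ h + (π ⬝ᵥ h) • one := fun _ => rfl
  have hπL : ∀ h, π ⬝ᵥ L h = π ⬝ᵥ h := by
    intro h
    rw [hL, dotProduct_add, dotProduct_sub, hπP, dotProduct_smul, hπ1]
    simp
  have hinj : Function.Injective L := by
    rw [injective_iff_map_eq_zero]
    intro h h0
    have h1 : π ⬝ᵥ h = 0 := by rw [← hπL, h0, dotProduct_zero]
    rw [hL, h1, zero_smul, add_zero, sub_eq_zero] at h0
    have hc := hh h h0.symm
    funext a
    have : h = h a • one := by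
      funext b; simp [one, hc b a]
    rw [this, dotProduct_smul, hπ1] at h1
    simpa using h1
  obtain ⟨h, rfl⟩ := LinearMap.injective_iff_surjective.1 hinj F
  refine ⟨h, ?_⟩
  rw [hπL, hL]
  funext a
  simp [one]

/-- Two stationary distributions agree on every `F`, as seen by pairing the second one with the
Poisson equation of the first. -/
theorem IsStationary.eq_of_const
    (hh : ∀ h : ι → ℝ, P *ᵥ h = h → ∀ a b, h a = h b) {π π' : ι → ℝ}
    (hπ : IsStationary P π) (hπ' : IsStationary P π') : π' = π := by
  have key : ∀ F : ι → ℝ, π' ⬝ᵥ F = π ⬝ᵥ F := by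
    intro F
    obtain ⟨h, hF⟩ := exists_sub_mulVec_eq hπ hh F
    have h1 : π' ⬝ᵥ h = π' ⬝ᵥ F - π ⬝ᵥ F + π' ⬝ᵥ h := by
      conv_lhs => rw [hF]
      rw [dotProduct_add, dotProduct_sub, Matrix.dotProduct_mulVec, hπ'.2]
      have : π' ⬝ᵥ (fun _ : ι => π ⬝ᵥ F) = π ⬝ᵥ F := by
        simp only [dotProduct, ← Finset.sum_mul]
        rw [hπ'.1.2, one_mul]
      rw [this]
    linarith
  classical
  funext a
  simpa using key (Pi.single a 1)

variable [DecidableEq ι]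

/-- A left eigenvector `v` for the eigenvalue `1` exists since `1` is a right one; then `|v|`
satisfies `|v| ≤ |v| P` entrywise with equal sums, so `|v|` is invariant too. -/
theorem exists_isStationary [Nonempty ι] (hP : P ∈ Matrix.rowStochastic ℝ ι) :
    ∃ π, IsStationary P π := by
  have hdet : (P - 1).det = 0 := by
    rw [← Matrix.exists_mulVec_eq_zero_iff]
    exact ⟨1, one_ne_zero, by rw [Matrix.sub_mulVec, hP.2, Matrix.one_mulVec, sub_self]⟩
  obtain ⟨v, hv0, hv⟩ := Matrix.exists_vecMul_eq_zero_iff.2 hdet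
  rw [Matrix.vecMul_sub, Matrix.vecMul_one, sub_eq_zero] at hv
  have hle : ∀ b, |v b| ≤ ∑ a, |v a| * P a b := by
    intro b
    have h1 : v b = ∑ a, v a * P a b := (congrFun hv b).symm
    calc |v b| = |∑ a, v a * P a b| := by rw [← h1]
      _ ≤ ∑ a, |v a * P a b| := Finset.abs_sum_le_sum_abs _ _
      _ = ∑ a, |v a| * P a b :=
          Finset.sum_congr rfl fun a _ => by rw [abs_mul, abs_of_nonneg (hP.1 a b)]
  have hsum : ∑ b, |v b| = ∑ b, ∑ a, |v a| * P a b := by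
    rw [Finset.sum_comm]
    refine Finset.sum_congr rfl fun a _ => ?_
    rw [← Finset.mul_sum, Matrix.sum_row_of_mem_rowStochastic hP, mul_one]
  have heq := (Finset.sum_eq_sum_iff_of_le fun b _ => hle b).1 hsum
  have hpos : 0 < ∑ b, |v b| := by
    obtain ⟨b, hb⟩ := Function.ne_iff.1 hv0
    exact Finset.sum_pos' (fun _ _ => abs_nonneg _) ⟨b, Finset.mem_univ b, abs_pos.2 hb⟩
  refine ⟨fun a => (∑ b, |v b|)⁻¹ * |v a|, ⟨fun a => by positivity, ?_⟩, ?_⟩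
  · rw [← Finset.mul_sum, inv_mul_cancel₀ hpos.ne']
  · funext b
    simp only [Matrix.vecMul, dotProduct, mul_assoc, ← Finset.mul_sum]
    rw [heq b (Finset.mem_univ b)]

/-- The maximum principle: harmonic functions of an irreducible stochastic matrix are constant. -/
theorem eq_of_mulVec_eq_self (hP : P ∈ Matrix.rowStochastic ℝ ι) {adj : ι → ι → Prop}
    (hpos : ∀ a b, adj a b → 0 < P a b) (hconn : ∀ a b, Relation.ReflTransGen adj a b)
    {h : ι → ℝ} (hh : P *ᵥ h = h) (a b : ι) : h a = h b := by
  have : Nonempty ι := ⟨a⟩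
  obtain ⟨m, hm⟩ := Finite.exists_max h
  -- The set of maximum points is closed under `adj`.
  have hstep : ∀ c d, adj c d → h c = h m → h d = h m := by
    intro c d hcd hc
    have h0 : ∑ e, P c e * (h m - h e) = 0 := by
      simp only [mul_sub, Finset.sum_sub_distrib, ← Finset.sum_mul]
      rw [Matrix.sum_row_of_mem_rowStochastic hP]
      have := congrFun hh c
      simp only [Matrix.mulVec, dotProduct] at this
      rw [this, hc]; ring
    have h1 := (Finset.sum_eq_zero_iff_of_nonneg fun e _ =>
      mul_nonneg (hP.1 c e) (sub_nonneg.2 (hm e))).1 h0 d (Finset.mem_univ d)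
    have := (mul_eq_zero.1 h1).resolve_left (hpos c d hcd).ne'
    linarith
  have hall : ∀ c, h c = h m := by
    intro c
    induction hconn m c with
    | refl => rfl
    | tail _ hcd ih => exact hstep _ _ hcd ih
  rw [hall a, hall b]

theorem pow_pos_of_pos {adj : ι → ι → Prop} (hrefl : ∀ a, adj a a)
    (hP : P ∈ Matrix.rowStochastic ℝ ι) (hP' : ∀ a b, adj a b → 0 < P a b) {n : ℕ} (hn : 1 ≤ n)
    (a b : ι) (hab : adj a b) : 0 < (P ^ n) a b := by
  induction n, hn using Nat.le_induction generalizing a b with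
  | base => simpa using hP' a b hab
  | succ n _ ih =>
    rw [pow_succ]
    exact mul_pos_of_pos hrefl (pow_mem hP n).1 hP.1 ih hP' a b hab

end Stochastic

/-! ### A law of large numbers for nonhomogeneous Markov chains -/

section Martingale

variable {Ω ι : Type*} [MeasurableSpace Ω] {ℙ : Measure Ω}

variable [MeasurableSpace ι]

variable {Q : ℕ → Matrix ι ι ℝ} {X : ℕ → Ω → ι}

theorem IsMarkovChain.measurable_path (hX : IsMarkovChain ℙ Q X) (n : ℕ) :
    Measurable fun ω => (fun k : Fin n => X k ω) :=
  measurable_pi_lambda _ fun k => hX.measurable k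

theorem IsMarkovChain.measureReal_snoc (hX : IsMarkovChain ℙ Q X) {n : ℕ}
    (w : Fin (n + 1) → ι) (b : ι) :
    ℙ.real {ω | (fun k : Fin (n + 1 + 1) => X k ω) = Fin.snoc w b}
      = ℙ.real {ω | (fun k : Fin (n + 1) => X k ω) = w} * Q n (w (Fin.last n)) b := by
  have h := hX.step n fun k => if hk : k < n + 1 then w ⟨k, hk⟩ else b
  have h1 : {ω | ∀ k ≤ n, X k ω = if hk : k < n + 1 then w ⟨k, hk⟩ else b}
      = {ω | (fun k : Fin (n + 1) => X k ω) = w} := by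
    ext ω
    simp only [Set.mem_ofPred_eq, funext_iff]
    constructor
    · intro hω k
      have := hω k (Nat.lt_succ_iff.1 k.2)
      rwa [dif_pos k.2] at this
    · intro hω k hk
      rw [dif_pos (Nat.lt_succ_iff.2 hk)]
      exact hω ⟨k, Nat.lt_succ_iff.2 hk⟩
  have h2 : {ω | ∀ k ≤ n + 1, X k ω = if hk : k < n + 1 then w ⟨k, hk⟩ else b}
      = {ω | (fun k : Fin (n + 1 + 1) => X k ω) = Fin.snoc w b} := by
    ext ω
    simp only [Set.mem_ofPred_eq, funext_iff]
    constructor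
    · intro hω k
      refine Fin.lastCases ?_ (fun j => ?_) k
      · simpa using hω (n + 1) le_rfl
      · have := hω j j.2.le
        rw [dif_pos j.2] at this
        simpa using this
    · intro hω k hk
      rcases Nat.lt_or_ge k (n + 1) with hlt | hge
      · have := hω (Fin.castSucc ⟨k, hlt⟩)
        rw [Fin.snoc_castSucc] at this
        simpa [hlt] using this
      · obtain rfl : k = n + 1 := le_antisymm hk hge
        have := hω (Fin.last (n + 1))
        rw [Fin.snoc_last] at this
        simpa using this
  rw [h1, h2] at h
  simpa [Fin.last] using h

variable [IsProbabilityMeasure ℙ]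

/-- If bounded random variables `D_n` have partial sums with second moments `O(n)`, then
`n⁻¹ (D_0 + ⋯ + D_{n-1}) → 0` almost surely: along the squares by summability of
the second moments, and in between since the increments are bounded. -/
theorem ae_tendsto_inv_mul_sum_of_integral_sq_le {D : ℕ → Ω → ℝ} {C : ℝ}
    (hmeas : ∀ n, Measurable (D n)) (hD : ∀ n ω, |D n ω| ≤ C)
    (hsq : ∀ n, ∫ ω, (∑ k ∈ Finset.range n, D k ω) ^ 2 ∂ℙ ≤ n * C ^ 2) :
    ∀ᵐ ω ∂ℙ, Tendsto (fun n : ℕ => (n : ℝ)⁻¹ * ∑ k ∈ Finset.range n, D k ω) atTop (𝓝 0) := by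
  set M : ℕ → Ω → ℝ := fun n ω => ∑ k ∈ Finset.range n, D k ω with hM
  have hMmeas : ∀ n, Measurable (M n) := fun n =>
    Finset.measurable_fun_sum _ fun k _ => hmeas k
  have hC : 0 ≤ C := by
    obtain ⟨ω⟩ := nonempty_of_isProbabilityMeasure ℙ
    exact (abs_nonneg _).trans (hD 0 ω)
  have hMbd : ∀ n ω, |M n ω| ≤ n * C := fun n ω =>
    (Finset.abs_sum_le_sum_abs _ _).trans <|
      (Finset.sum_le_sum fun k _ => hD k ω).trans (by simp)
  have hint : ∀ n, Integrable (fun ω => (M n ω) ^ 2) ℙ := fun n =>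
    Integrable.of_bound ((hMmeas n).pow_const 2).aestronglyMeasurable ((n * C) ^ 2)
      (Eventually.of_forall fun ω => by
        rw [Real.norm_eq_abs, abs_pow]
        exact pow_le_pow_left₀ (abs_nonneg _) (hMbd n ω) 2)
  -- the random variables `(M_{k²} / k²)²`, shifted so that no denominator vanishes
  let Y : ℕ → Ω → ℝ := fun k ω => ((((k + 1) ^ 2 : ℕ) : ℝ)⁻¹ * M ((k + 1) ^ 2) ω) ^ 2
  have hYint : ∀ k, Integrable (Y k) ℙ := fun k => by
    simp only [Y, mul_pow]
    exact (hint _).const_mul _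
  have hYle : ∀ k, ∫ ω, Y k ω ∂ℙ ≤ C ^ 2 * (1 / ((k + 1 : ℕ) : ℝ) ^ 2) := by
    intro k
    simp only [Y, mul_pow]
    rw [integral_const_mul]
    refine (mul_le_mul_of_nonneg_left (hsq _) (by positivity)).trans (le_of_eq ?_)
    push_cast
    field_simp
  have hsum : Summable fun k : ℕ => C ^ 2 * (1 / ((k + 1 : ℕ) : ℝ) ^ 2) :=
    ((summable_nat_add_iff 1).2 (Real.summable_one_div_nat_pow.2 one_lt_two)).mul_left _
  have hY : ∀ᵐ ω ∂ℙ, Tendsto (fun k => Y k ω) atTop (𝓝 0) := by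
    have hfin : ∫⁻ ω, ∑' k, ENNReal.ofReal (Y k ω) ∂ℙ ≠ ⊤ := by
      rw [lintegral_tsum fun k => (hYint k).1.aemeasurable.ennreal_ofReal]
      refine ne_top_of_le_ne_top hsum.tsum_ofReal_ne_top (ENNReal.tsum_le_tsum fun k => ?_)
      rw [← ofReal_integral_eq_lintegral_ofReal (hYint k)
        (Eventually.of_forall fun ω => sq_nonneg _)]
      exact ENNReal.ofReal_le_ofReal (hYle k)
    have hae : AEMeasurable (fun ω => ∑' k, ENNReal.ofReal (Y k ω)) ℙ :=
      AEMeasurable.tsum fun k => (hYint k).1.aemeasurable.ennreal_ofReal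
    filter_upwards [ae_lt_top' hae hfin] with ω hω
    have h1 := ENNReal.tendsto_atTop_zero_of_tsum_ne_top hω.ne
    have h2 := (ENNReal.tendsto_toReal ENNReal.zero_ne_top).comp h1
    refine h2.congr fun k => ?_
    exact ENNReal.toReal_ofReal (sq_nonneg _)
  filter_upwards [hY] with ω hω
  have h1 : Tendsto (fun k : ℕ => |(((k ^ 2 : ℕ) : ℝ)⁻¹ * M (k ^ 2) ω)|) atTop (𝓝 0) := by
    rw [← tendsto_add_atTop_iff_nat 1]
    have := hω.sqrt
    rw [Real.sqrt_zero] at this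
    exact this.congr fun k => Real.sqrt_sq_eq_abs _
  have h2 : Tendsto (fun k : ℕ => |(((k ^ 2 : ℕ) : ℝ)⁻¹ * M (k ^ 2) ω)| + 2 * C * (k : ℝ)⁻¹)
      atTop (𝓝 0) := by
    simpa using h1.add (tendsto_inv_atTop_nhds_zero_nat.const_mul (2 * C))
  have hsqrt : Tendsto Nat.sqrt atTop atTop :=
    tendsto_atTop.2 fun b => (eventually_ge_atTop (b * b)).mono fun a ha => Nat.le_sqrt.2 ha
  refine squeeze_zero_norm' ?_ (h2.comp hsqrt)
  filter_upwards [eventually_ge_atTop 1] with n hn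
  -- compare `n` with the largest square `k²` below it
  set k := Nat.sqrt n with hk
  have hk1 : 1 ≤ k := Nat.le_sqrt.2 (by simpa using hn)
  have hkn : k ^ 2 ≤ n := Nat.sqrt_le' n
  have hnk : n ≤ k ^ 2 + 2 * k := by
    have := Nat.sqrt_le_add n
    rw [← hk] at this; nlinarith
  have hdiff : |M n ω| ≤ |M (k ^ 2) ω| + 2 * k * C := by
    have h3 : M n ω = M (k ^ 2) ω + ∑ j ∈ Finset.Ico (k ^ 2) n, D j ω :=
      (Finset.sum_range_add_sum_Ico _ hkn).symm
    have h4 : |∑ j ∈ Finset.Ico (k ^ 2) n, D j ω| ≤ ((n - k ^ 2 : ℕ) : ℝ) * C :=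
      (Finset.abs_sum_le_sum_abs _ _).trans <|
        (Finset.sum_le_sum fun j _ => hD j ω).trans (by simp)
    have h5 : ((n - k ^ 2 : ℕ) : ℝ) ≤ 2 * k := by
      exact_mod_cast Nat.sub_le_iff_le_add'.2 hnk
    rw [h3]
    refine (abs_add_le _ _).trans (add_le_add_right (h4.trans ?_) _)
    exact mul_le_mul_of_nonneg_right h5 hC
  have hkpos : (0 : ℝ) < k := by exact_mod_cast hk1
  have hknR : (k : ℝ) ^ 2 ≤ n := by exact_mod_cast hkn
  have hgoal : |(n : ℝ)⁻¹ * M n ω| ≤ |((k ^ 2 : ℕ) : ℝ)⁻¹ * M (k ^ 2) ω| + 2 * C * (k : ℝ)⁻¹ := by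
    rw [abs_mul, abs_mul, abs_inv, abs_inv, Nat.abs_cast, Nat.abs_cast]
    calc (n : ℝ)⁻¹ * |M n ω| ≤ ((k : ℝ) ^ 2)⁻¹ * (|M (k ^ 2) ω| + 2 * k * C) := by
          gcongr
      _ = _ := by
          push_cast
          field_simp
  exact hgoal

variable [Fintype ι] [MeasurableSingletonClass ι]

theorem IsMarkovChain.integral_path (hX : IsMarkovChain ℙ Q X) {n : ℕ}
    (F : (Fin n → ι) → ℝ) :
    ∫ ω, F (fun k : Fin n => X k ω) ∂ℙ
      = ∑ w, ℙ.real {ω | (fun k : Fin n => X k ω) = w} * F w := by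
  have hm := hX.measurable_path n
  have : IsProbabilityMeasure (ℙ.map fun ω => (fun k : Fin n => X k ω)) :=
    Measure.isProbabilityMeasure_map hm.aemeasurable
  rw [← integral_map (f := F) hm.aemeasurable (by fun_prop), integral_fintype .of_finite]
  refine Finset.sum_congr rfl fun w _ => ?_
  rw [smul_eq_mul, map_measureReal_apply hm (measurableSet_singleton w)]
  rfl

/-- If `g (X_n, X_{n+1})` has conditional mean zero given `X_n`, then it is orthogonal to every
function of `X_0, …, X_n`. -/
theorem IsMarkovChain.integral_mul_eq_zero (hX : IsMarkovChain ℙ Q X) {n : ℕ}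
    (F : (Fin (n + 1) → ι) → ℝ) {g : ι → ι → ℝ} (hg : ∀ a, ∑ b, Q n a b * g a b = 0) :
    ∫ ω, F (fun k : Fin (n + 1) => X k ω) * g (X n ω) (X (n + 1) ω) ∂ℙ = 0 := by
  have h := hX.integral_path (n := n + 1 + 1)
    (fun w => F (Fin.init w) * g (w (Fin.last n).castSucc) (w (Fin.last (n + 1))))
  have hl : ∀ ω, (F (Fin.init fun k : Fin (n + 1 + 1) => X k ω)
      * g (X ((Fin.last n).castSucc : Fin (n + 1 + 1)) ω) (X (Fin.last (n + 1)) ω))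
      = F (fun k : Fin (n + 1) => X k ω) * g (X n ω) (X (n + 1) ω) := fun ω => rfl
  simp only [hl] at h
  rw [h, ← (Fin.snocEquiv fun _ => ι).sum_comp, Fintype.sum_prod_type_right]
  refine Finset.sum_eq_zero fun w _ => ?_
  have hs : ∀ b, (Fin.snocEquiv fun _ : Fin (n + 1 + 1) => ι) (b, w)
      = (Fin.snoc w b : Fin (n + 1 + 1) → ι) := fun b => rfl
  simp only [hs, hX.measureReal_snoc, Fin.init_snoc, Fin.snoc_castSucc, Fin.snoc_last]
  rw [← mul_zero (ℙ.real {ω | (fun k : Fin (n + 1) => X k ω) = w} * F w), ← hg (w (Fin.last n)),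
    Finset.mul_sum]
  exact Finset.sum_congr rfl fun b _ => by ring

/-- The strong law for sums of bounded martingale differences along the chain. -/
theorem IsMarkovChain.ae_tendsto_inv_mul_sum_zero (hX : IsMarkovChain ℙ Q X)
    {g : ℕ → ι → ι → ℝ} {C : ℝ} (hC : ∀ n a b, |g n a b| ≤ C)
    (hg : ∀ n a, ∑ b, Q n a b * g n a b = 0) :
    ∀ᵐ ω ∂ℙ, Tendsto
      (fun n : ℕ => (n : ℝ)⁻¹ * ∑ k ∈ Finset.range n, g k (X k ω) (X (k + 1) ω))
      atTop (𝓝 0) := by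
  have hmeas : ∀ n, Measurable fun ω => g n (X n ω) (X (n + 1) ω) := fun n =>
    (Measurable.of_discrete (f := fun z : ι × ι => g n z.1 z.2)).comp
      ((hX.measurable n).prodMk (hX.measurable (n + 1)))
  refine ae_tendsto_inv_mul_sum_of_integral_sq_le hmeas (fun n ω => hC n _ _) fun n => ?_
  induction n with
  | zero => simp
  | succ n ih =>
    have hM : ∀ ω, ∑ k ∈ Finset.range n, g k (X k ω) (X (k + 1) ω)
        = (fun w : Fin (n + 1) → ι => ∑ k : Fin n, g k (w k.castSucc) (w k.succ))
          (fun k : Fin (n + 1) => X k ω) := fun ω =>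
      (Fin.sum_univ_eq_sum_range (fun k => g k (X k ω) (X (k + 1) ω)) n).symm
    have hbd : ∀ ω, |∑ k ∈ Finset.range n, g k (X k ω) (X (k + 1) ω)| ≤ n * C := fun ω =>
      (Finset.abs_sum_le_sum_abs _ _).trans <|
        (Finset.sum_le_sum fun k _ => hC k _ _).trans (by simp)
    have hMm : Measurable fun ω => ∑ k ∈ Finset.range n, g k (X k ω) (X (k + 1) ω) :=
      Finset.measurable_fun_sum _ fun k _ => hmeas k
    have h0 : ∫ ω, (∑ k ∈ Finset.range n, g k (X k ω) (X (k + 1) ω))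
        * g n (X n ω) (X (n + 1) ω) ∂ℙ = 0 := by
      simp only [hM]
      exact hX.integral_mul_eq_zero
        (fun w : Fin (n + 1) → ι => ∑ k : Fin n, g k (w k.castSucc) (w k.succ)) (hg n)
    have hi1 : Integrable
        (fun ω => (∑ k ∈ Finset.range n, g k (X k ω) (X (k + 1) ω)) ^ 2) ℙ :=
      Integrable.of_bound (hMm.pow_const 2).aestronglyMeasurable ((n * C) ^ 2)
        (Eventually.of_forall fun ω => by
          rw [Real.norm_eq_abs, abs_pow]
          exact pow_le_pow_left₀ (abs_nonneg _) (hbd ω) 2)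
    have hi2 : Integrable (fun ω => (∑ k ∈ Finset.range n, g k (X k ω) (X (k + 1) ω))
        * g n (X n ω) (X (n + 1) ω)) ℙ :=
      Integrable.of_bound (hMm.mul (hmeas n)).aestronglyMeasurable (n * C * C)
        (Eventually.of_forall fun ω => by
          rw [Real.norm_eq_abs, abs_mul]
          exact mul_le_mul (hbd ω) (hC n _ _) (abs_nonneg _) ((abs_nonneg _).trans (hbd ω)))
    have hi3 : Integrable (fun ω => g n (X n ω) (X (n + 1) ω) ^ 2) ℙ :=
      Integrable.of_bound ((hmeas n).pow_const 2).aestronglyMeasurable (C ^ 2)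
        (Eventually.of_forall fun ω => by
          rw [Real.norm_eq_abs, abs_pow]
          exact pow_le_pow_left₀ (abs_nonneg _) (hC n _ _) 2)
    have h3 : ∫ ω, g n (X n ω) (X (n + 1) ω) ^ 2 ∂ℙ ≤ C ^ 2 := by
      refine (integral_mono hi3 (integrable_const (C ^ 2)) fun ω => ?_).trans (by simp)
      rw [← sq_abs]
      exact pow_le_pow_left₀ (abs_nonneg _) (hC n _ _) 2
    have hexp : ∀ ω, (∑ k ∈ Finset.range (n + 1), g k (X k ω) (X (k + 1) ω)) ^ 2
        = (∑ k ∈ Finset.range n, g k (X k ω) (X (k + 1) ω)) ^ 2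
          + 2 * ((∑ k ∈ Finset.range n, g k (X k ω) (X (k + 1) ω))
            * g n (X n ω) (X (n + 1) ω)) + g n (X n ω) (X (n + 1) ω) ^ 2 := fun ω => by
      rw [Finset.sum_range_succ]; ring
    simp only [hexp]
    have hi12 := hi1.add (hi2.const_mul 2)
    simp only [Pi.add_def] at hi12
    rw [integral_add hi12 hi3, integral_add hi1 (hi2.const_mul 2), integral_const_mul, h0]
    push_cast
    linarith

/-- If `u` is a bounded solution of the Poisson equation
`u_n a = E [w (X_n, X_{n+1}) - μ + u_{n+1} (X_{n+1}) | X_n = a]`, then the averages of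
`w (X_n, X_{n+1})` converge to `μ`: up to a martingale, their sum minus `n μ` telescopes. -/
theorem IsMarkovChain.ae_tendsto_inv_mul_sum (hX : IsMarkovChain ℙ Q X) {w : ι → ι → ℝ} {μ C : ℝ}
    {u : ℕ → ι → ℝ} (hu : ∀ n a, |u n a| ≤ C)
    (hpoisson : ∀ n a, ∑ b, Q n a b * (w a b - μ + u (n + 1) b - u n a) = 0) :
    ∀ᵐ ω ∂ℙ, Tendsto
      (fun n : ℕ => (n : ℝ)⁻¹ * ∑ k ∈ Finset.range n, w (X k ω) (X (k + 1) ω))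
      atTop (𝓝 μ) := by
  obtain ⟨K, hK⟩ : ∃ K, ∀ z : ι × ι, |w z.1 z.2| ≤ K := by
    obtain ⟨K, hK⟩ := (Set.finite_range fun z : ι × ι => |w z.1 z.2|).bddAbove
    exact ⟨K, fun z => hK ⟨z, rfl⟩⟩
  have hbd : ∀ n a b, |w a b - μ + u (n + 1) b - u n a| ≤ K + |μ| + C + C := by
    intro n a b
    have h1 := abs_le.1 (hK (a, b))
    have h2 := abs_le.1 (hu (n + 1) b)
    have h3 := abs_le.1 (hu n a)
    have h4 := le_abs_self μ
    have h5 := neg_abs_le μ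
    rw [abs_le]
    constructor <;> linarith [h1.1, h1.2, h2.1, h2.2, h3.1, h3.2]
  filter_upwards [hX.ae_tendsto_inv_mul_sum_zero hbd hpoisson] with ω hω
  have hu0 : Tendsto (fun n : ℕ => (n : ℝ)⁻¹ * (u 0 (X 0 ω) - u n (X n ω))) atTop (𝓝 0) := by
    refine squeeze_zero_norm (a := fun n : ℕ => (n : ℝ)⁻¹ * (C + C)) (fun n => ?_)
      (by simpa using tendsto_inv_atTop_nhds_zero_nat.mul_const (C + C))
    rw [norm_mul, Real.norm_eq_abs, Real.norm_eq_abs, abs_of_nonneg (by positivity)]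
    gcongr
    exact (abs_sub _ _).trans (add_le_add (hu _ _) (hu _ _))
  have h := (hω.add hu0).add_const μ
  rw [zero_add, zero_add] at h
  refine h.congr' ?_
  filter_upwards [eventually_ge_atTop 1] with n hn
  have hn0 : (n : ℝ) ≠ 0 := by positivity
  have hsum : ∑ k ∈ Finset.range n,
      (w (X k ω) (X (k + 1) ω) - μ + u (k + 1) (X (k + 1) ω) - u k (X k ω))
      = ∑ k ∈ Finset.range n, w (X k ω) (X (k + 1) ω) - n * μ
        + (u n (X n ω) - u 0 (X 0 ω)) := by
    rw [← Finset.sum_range_sub (fun k => u k (X k ω)), Finset.sum_congr rfl fun k _ =>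
      add_sub_assoc (w (X k ω) (X (k + 1) ω) - μ) _ _]
    rw [Finset.sum_add_distrib, Finset.sum_sub_distrib]
    simp
  rw [hsum]
  field_simp
  ring

end Martingale

/-! ### The Poisson equation for a periodic pattern of two matrices -/

/-- A solution `h` of the Poisson equation for the product `A ^ r * B ^ s` unrolls to a periodic,
hence bounded, solution of the time-dependent Poisson equation with `r` steps of `A` and reward `0`
followed by `s` steps of `B` and reward `g`. -/
theorem exists_periodic_poisson {ι : Type*} [Fintype ι] [DecidableEq ι] {A B : Matrix ι ι ℝ}
    (hA : A *ᵥ 1 = 1) (hB : B *ᵥ 1 = 1) {g h : ι → ℝ} {μ : ℝ} {r s : ℕ} (hs : 1 ≤ s)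
    (hh : h = ∑ v ∈ Finset.range s, A ^ r *ᵥ (B ^ v *ᵥ g) - (((r : ℝ) + s) * μ) • 1
      + (A ^ r * B ^ s) *ᵥ h) :
    ∃ H : ℕ → ι → ℝ, (∃ C, ∀ n a, |H n a| ≤ C) ∧
      ∀ n, H n = if n % (r + s) < r then A *ᵥ H (n + 1) - μ • 1
        else g + B *ᵥ H (n + 1) - μ • 1 := by
  -- `V j` is the solution when `j` steps of the current period remain.
  let V : ℕ → ι → ℝ := fun j => Nat.rec h (fun j v =>
    if j < s then g + B *ᵥ v - μ • 1 else A *ᵥ v - μ • 1) j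
  have hV0 : V 0 = h := rfl
  have hV : ∀ j, V (j + 1) = if j < s then g + B *ᵥ V j - μ • 1 else A *ᵥ V j - μ • 1 :=
    fun j => rfl
  have hVB : ∀ j ≤ s, V j = ∑ v ∈ Finset.range j, B ^ v *ᵥ g + B ^ j *ᵥ h - ((j : ℝ) * μ) • 1 := by
    intro j
    induction j with
    | zero => intro _; simp [hV0]
    | succ j ih =>
      intro hj
      rw [hV, if_pos (Nat.lt_of_succ_le hj), ih (Nat.le_of_succ_le hj), Matrix.mulVec_sub,
        Matrix.mulVec_add, Matrix.mulVec_sum, Matrix.mulVec_smul, hB, Finset.sum_range_succ']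
      simp only [Matrix.mulVec_mulVec, ← pow_succ', pow_zero, Matrix.one_mulVec]
      push_cast
      module
  have hVA : ∀ i, V (s + i) = A ^ i *ᵥ (∑ v ∈ Finset.range s, B ^ v *ᵥ g + B ^ s *ᵥ h)
      - (((i : ℝ) + s) * μ) • 1 := by
    intro i
    induction i with
    | zero => simp [hVB s le_rfl]
    | succ i ih =>
      rw [← add_assoc, hV, if_neg (by omega), ih, Matrix.mulVec_sub, Matrix.mulVec_smul, hA,
        Matrix.mulVec_mulVec, ← pow_succ']
      push_cast
      module
  have hVT : V (r + s) = h := by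
    rw [add_comm, hVA, Matrix.mulVec_add, Matrix.mulVec_sum, Matrix.mulVec_mulVec]
    conv_rhs => rw [hh]
    abel
  refine ⟨fun n => V (r + s - n % (r + s)), ?_, fun n => ?_⟩
  · obtain ⟨C, hC⟩ :=
      (Set.finite_range fun z : Fin (r + s + 1) × ι => |V z.1 z.2|).bddAbove
    exact ⟨C, fun n a => hC ⟨(⟨r + s - n % (r + s), by omega⟩, a), rfl⟩⟩
  · have hT : n % (r + s) < r + s := Nat.mod_lt _ (by omega)
    obtain ⟨j, hj⟩ : ∃ j, r + s - n % (r + s) = j + 1 := ⟨r + s - n % (r + s) - 1, by omega⟩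
    have hnext : V (r + s - (n + 1) % (r + s)) = V j := by
      rcases Nat.lt_or_ge (n % (r + s) + 1) (r + s) with hlt | hge
      · have : (n + 1) % (r + s) = n % (r + s) + 1 := by
          rw [Nat.add_mod_eq_add_mod_right 1 (Nat.mod_mod n (r + s)).symm, Nat.mod_eq_of_lt hlt]
        rw [this]
        congr 1
        omega
      · have hlast : n % (r + s) + 1 = r + s := by omega
        have : (n + 1) % (r + s) = 0 := by
          rw [Nat.add_mod_eq_add_mod_right 1 (Nat.mod_mod n (r + s)).symm, hlast, Nat.mod_self]
        have hj0 : j = 0 := by omega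
        rw [this, hj0, Nat.sub_zero, hVT, hV0]
    simp only [hnext]
    rw [hj, hV]
    by_cases hn : n % (r + s) < r
    · rw [if_pos hn, if_neg (by omega)]
    · rw [if_neg hn, if_pos (by omega)]

/-! ### The matrices of the game -/

section Game

variable {N : ℕ} {p q : Fin 4 → ℝ} {G : Subgroup (Equiv.Perm (Fin N))}

theorem flip_ne (x : Config N) (i : Fin N) : flip x i ≠ x := by
  intro h
  have := congrFun h i
  simp [flip] at this

theorem formMatrix_mulVec (φ : Config N → ℝ) (x : Config N) :
    (formMatrix N p q *ᵥ φ) x = (N : ℝ)⁻¹ * ∑ i,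
      ((if x i = false then p (nbr x i) else q (nbr x i)) * φ (flip x i)
        + (if x i = false then q (nbr x i) else p (nbr x i)) * φ x) := by
  have h1 : ∑ i : Fin N with x i = true, p (nbr x i)
      = ∑ i : Fin N with ¬ x i = false, p (nbr x i) := by simp
  simp only [Matrix.mulVec, dotProduct, formMatrix, add_mul, Finset.sum_add_distrib,
    Finset.sum_mul, ite_mul, zero_mul]
  rw [Finset.sum_comm, h1, ← Finset.sum_ite]
  simp only [Finset.sum_ite_eq', Finset.mem_univ, if_true, mul_assoc, mul_add,
    Finset.mul_sum, Finset.sum_mul, ite_mul]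

theorem reduce_mulVec {P : Matrix (Config N) (Config N) ℝ} (hP : IsInvariant G P)
    (φ : Classes G → ℝ) (x : Config N) :
    (reduce G P *ᵥ φ) (cls G x) = (P *ᵥ fun y => φ (cls G y)) x := by
  simp only [Matrix.mulVec, dotProduct]
  rw [← Finset.sum_fiberwise (s := Finset.univ) (g := cls G)]
  refine Finset.sum_congr rfl fun b _ => ?_
  rw [← cls_rep b, reduce_cls hP, Finset.sum_mul]
  refine Finset.sum_congr rfl fun y hy => ?_
  rw [(Finset.mem_filter.1 hy).2]

theorem formMatrix_nonneg (hp : ∀ m, 0 ≤ p m) (hq : ∀ m, 0 ≤ q m) (x y : Config N) :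
    0 ≤ formMatrix N p q x y := by
  have h := formMatrix_mulVec (p := p) (q := q) (Pi.single y 1) x
  rw [Matrix.mulVec_single_one] at h
  rw [show formMatrix N p q x y = (formMatrix N p q).col y x from rfl, h]
  refine mul_nonneg (by positivity) (Finset.sum_nonneg fun i _ => ?_)
  have h1 : ∀ z, (0 : ℝ) ≤ (Pi.single y 1 : Config N → ℝ) z := fun z => by
    by_cases hz : z = y <;> simp [hz]
  refine add_nonneg (mul_nonneg ?_ (h1 _)) (mul_nonneg ?_ (h1 _)) <;> split_ifs <;> simp [hp, hq]

theorem formMatrix_flip_pos (hp : ∀ m, 0 < p m) (hq : ∀ m, 0 < q m) (x : Config N) (i : Fin N) :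
    0 < formMatrix N p q x (flip x i) := by
  have hN : (0 : ℝ) < N := by exact_mod_cast i.pos
  unfold formMatrix
  rw [if_neg (flip_ne x i), add_zero]
  have h0 : ∀ j, 0 < (N : ℝ)⁻¹ * (if x j = false then p (nbr x j) else q (nbr x j)) := fun j => by
    have := hp (nbr x j)
    have := hq (nbr x j)
    split_ifs <;> positivity
  refine Finset.sum_pos' (fun j _ => ?_) ⟨i, Finset.mem_univ i, ?_⟩
  · by_cases h : flip x i = flip x j
    · rw [if_pos h]; exact (h0 j).le
    · rw [if_neg h]
  · rw [if_pos rfl]; exact h0 i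

theorem formMatrix_self_pos (hN : 0 < N) (hp : ∀ m, 0 < p m) (hq : ∀ m, 0 < q m)
    (x : Config N) : 0 < formMatrix N p q x x := by
  have hN' : (0 : ℝ) < N := by exact_mod_cast hN
  unfold formMatrix
  have h1 : ∑ i : Fin N with x i = true, p (nbr x i)
      = ∑ i : Fin N with ¬ x i = false, p (nbr x i) := by simp
  rw [if_pos rfl, h1, ← Finset.sum_ite]
  refine add_pos_of_nonneg_of_pos (Finset.sum_nonneg fun i _ => ?_) (mul_pos (by positivity) ?_)
  · rw [if_neg (flip_ne x i).symm]
  · have : Nonempty (Fin N) := ⟨⟨0, hN⟩⟩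
    refine Finset.sum_pos (fun i _ => ?_) Finset.univ_nonempty
    split_ifs <;> simp [hp, hq]

theorem reduce_pos {P : Matrix (Config N) (Config N) ℝ} (hP : IsInvariant G P)
    (h0 : ∀ x y, 0 ≤ P x y) {x y : Config N} (hxy : 0 < P x y) :
    0 < reduce G P (cls G x) (cls G y) := by
  rw [reduce_cls hP]
  exact Finset.sum_pos' (fun z _ => h0 x z) ⟨y, by simp, hxy⟩

theorem reduce_matB_mem_rowStochastic (hN : 0 < N) (hp : ∀ m, 0 < p m ∧ p m < 1)
    (hinv : IsInvariant G (matB N p)) :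
    reduce G (matB N p) ∈ Matrix.rowStochastic ℝ (Classes G) := by
  have hN' : (N : ℝ) ≠ 0 := by positivity
  refine ⟨fun a b => Finset.sum_nonneg fun y _ => formMatrix_nonneg (fun m => (hp m).1.le)
    (fun m => sub_nonneg.2 (hp m).2.le) _ _, ?_⟩
  funext a
  rw [← cls_rep a, reduce_mulVec hinv, matB, formMatrix_mulVec]
  have : ∀ i : Fin N, (if rep a i = false then p (nbr (rep a) i) else 1 - p (nbr (rep a) i))
      * (1 : Classes G → ℝ) (cls G (flip (rep a) i))
      + (if rep a i = false then 1 - p (nbr (rep a) i) else p (nbr (rep a) i))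
      * (1 : Classes G → ℝ) (cls G (rep a)) = 1 := fun i => by
    split_ifs <;> simp
  simp only [this]
  simp [hN']

/-- Two classes are adjacent if they are equal or contain configurations that differ in exactly
one player. -/
def ClassAdj (G : Subgroup (Equiv.Perm (Fin N))) (a b : Classes G) : Prop :=
  a = b ∨ ∃ x i, a = cls G x ∧ b = cls G (flip x i)

/-- The players are switched one at a time, from a representative of `a` to one of `b`. -/
theorem reflTransGen_classAdj (a b : Classes G) : Relation.ReflTransGen (ClassAdj G) a b := by
  have key : ∀ s : Finset (Fin N),
      Relation.ReflTransGen (ClassAdj G) a (cls G (s.piecewise (rep b) (rep a))) := by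
    intro s
    induction s using Finset.induction_on with
    | empty => rw [Finset.piecewise_empty, cls_rep]
    | insert i s _ ih =>
      refine ih.tail ?_
      rw [Finset.piecewise_insert]
      by_cases h : rep b i = s.piecewise (rep b) (rep a) i
      · left; rw [h, Function.update_eq_self]
      · right
        refine ⟨_, i, rfl, ?_⟩
        rw [flip, Bool.eq_not_of_ne h]
  have := key Finset.univ
  rwa [Finset.piecewise_univ, cls_rep] at this

theorem reduce_matB_pos (hN : 0 < N) (hp : ∀ m, 0 < p m ∧ p m < 1)
    (hinv : IsInvariant G (matB N p)) (a b : Classes G) (hab : ClassAdj G a b) :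
    0 < reduce G (matB N p) a b := by
  have hq : ∀ m, 0 < 1 - p m := fun m => sub_pos.2 (hp m).2
  have h0 : ∀ x y, 0 ≤ matB N p x y :=
    formMatrix_nonneg (fun m => (hp m).1.le) (fun m => (hq m).le)
  rcases hab with rfl | ⟨x, i, rfl, rfl⟩
  · rw [← cls_rep a]
    exact reduce_pos hinv h0 (formMatrix_self_pos hN (fun m => (hp m).1) hq _)
  · exact reduce_pos hinv h0 (formMatrix_flip_pos (fun m => (hp m).1) hq _ _)

theorem isInvariant_formMatrix
    (hG : G = rotationGroup N ∨ G = dihedralGroup N ∧ p 1 = p 2 ∧ q 1 = q 2) :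
    IsInvariant G (formMatrix N p q) := by
  rcases hG with rfl | ⟨rfl, hp, hq⟩
  · exact isInvariant_rotationGroup N p q
  · exact isInvariant_dihedralGroup N hp hq

/-- One step of the augmented chain: player `i` plays, then the next player is drawn uniformly. -/
theorem sum_starB_mul (x : Config N) (i : Fin N) (ψ : Config N × Fin N → ℝ) :
    ∑ b, starB N p (x, i) b * ψ b
      = (if x i = false then p (nbr x i) else 1 - p (nbr x i))
          * ((N : ℝ)⁻¹ * ∑ j, ψ (flip x i, j))
        + (if x i = false then 1 - p (nbr x i) else p (nbr x i)) * ((N : ℝ)⁻¹ * ∑ j, ψ (x, j)) := by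
  have h : ∀ y j, starB N p (x, i) (y, j) * ψ (y, j)
      = (if y = flip x i then (N : ℝ)⁻¹ *
          (if x i = false then p (nbr x i) else 1 - p (nbr x i)) * ψ (y, j) else 0)
        + (if y = x then (N : ℝ)⁻¹ *
          (if x i = false then 1 - p (nbr x i) else p (nbr x i)) * ψ (y, j) else 0) := by
    intro y j
    unfold starB
    by_cases h1 : y = flip x i
    · have h2 : y ≠ x := h1 ▸ flip_ne x i
      simp only [h1, if_true, flip_ne, if_false, add_zero]
    · simp only [h1, if_false, zero_add]
      split_ifs <;> simp
  rw [Fintype.sum_prod_type_right]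
  simp only [h, Finset.sum_add_distrib, Finset.sum_ite_eq', Finset.mem_univ, if_true,
    ← Finset.mul_sum]
  ring

end Game

/-! ### From the reduced chain to the augmented chain -/

section Lift

variable {N : ℕ} {p : Fin 4 → ℝ} {G : Subgroup (Equiv.Perm (Fin N))}

/-- The expected value of the payoff, minus `μ`, plus `φ` at the class of the next configuration,
when player `z.2` plays in configuration `z.1`.  With `φ` a solution of the Poisson equation on
the classes at the next time, this solves the Poisson equation on `Σ^*` at the present time. -/
noncomputable def starLift (p : Fin 4 → ℝ) (μ : ℝ) (φ : Classes G → ℝ) (z : Config N × Fin N) : ℝ :=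
  (if z.1 z.2 = false then p (nbr z.1 z.2) else 1 - p (nbr z.1 z.2))
      * (φ (cls G (flip z.1 z.2)) + (if z.1 z.2 = false then 1 else -1))
    + (if z.1 z.2 = false then 1 - p (nbr z.1 z.2) else p (nbr z.1 z.2))
      * (φ (cls G z.1) - (if z.1 z.2 = false then 1 else -1)) - μ

/-- Averaging over the player turns the augmented step into the step of the reduced chain, and the
expected payoff into the row sums of the reduction of `Ṗ_B`. -/
theorem inv_mul_sum_starLift (hN : 0 < N) (hinv : IsInvariant G (matB N p))
    (hinv' : IsInvariant G (matBdot N p)) (μ : ℝ) (φ : Classes G → ℝ) (x : Config N) :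
    (N : ℝ)⁻¹ * ∑ j, starLift p μ φ (x, j)
      = (reduce G (matBdot N p) *ᵥ 1 + reduce G (matB N p) *ᵥ φ - μ • 1) (cls G x) := by
  have hN' : (N : ℝ) ≠ 0 := by positivity
  simp only [Pi.add_apply, Pi.sub_apply, Pi.smul_apply, Pi.one_apply, smul_eq_mul, mul_one]
  rw [reduce_mulVec hinv, reduce_mulVec hinv', matB, matBdot, formMatrix_mulVec,
    formMatrix_mulVec, ← mul_add, ← Finset.sum_add_distrib]
  simp only [starLift, Finset.sum_sub_distrib, Finset.sum_const, Finset.card_univ, Fintype.card_fin,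
    nsmul_eq_mul, mul_sub, inv_mul_cancel_left₀ hN', Pi.one_apply]
  congr 2
  refine Finset.sum_congr rfl fun i _ => ?_
  split_ifs <;> ring

/-- `starLift` satisfies the Poisson equation on `Σ^*` as soon as the function `u'` used at the next
time has averages over the player given by `φ`. -/
theorem sum_starB_payoff (hN : 0 < N) {μ : ℝ} {φ : Classes G → ℝ} {u' : Config N × Fin N → ℝ}
    (hu' : ∀ y, (N : ℝ)⁻¹ * ∑ j, u' (y, j) = φ (cls G y)) (z : Config N × Fin N) :
    ∑ b, starB N p z b * (payoff z b - μ + u' b - starLift p μ φ z) = 0 := by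
  have hN' : (N : ℝ) ≠ 0 := by positivity
  obtain ⟨x, i⟩ := z
  have hflip : ∀ j, payoff (x, i) (flip x i, j) = if x i = false then 1 else -1 := fun j => by
    simp [payoff]
  have hself : ∀ j, payoff (x, i) (x, j) = -if x i = false then 1 else -1 := fun j => by
    simp only [payoff, (flip_ne x i).symm, if_false, if_true]
    split_ifs <;> simp
  rw [sum_starB_mul]
  simp only [hflip, hself, Finset.sum_sub_distrib, Finset.sum_add_distrib, Finset.sum_const,
    Finset.card_univ, Fintype.card_fin, nsmul_eq_mul, mul_sub, mul_add,
    inv_mul_cancel_left₀ hN', hu']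
  simp only [starLift]
  split_ifs <;> ring

theorem abs_starLift_le (hp : ∀ m, 0 < p m ∧ p m < 1) {μ C : ℝ} {φ : Classes G → ℝ}
    (hφ : ∀ a, |φ a| ≤ C) (z : Config N × Fin N) : |starLift p μ φ z| ≤ C + 1 + |μ| := by
  have h1 := abs_le.1 (hφ (cls G (flip z.1 z.2)))
  have h2 := abs_le.1 (hφ (cls G z.1))
  have h3 := hp (nbr z.1 z.2)
  have h4 := abs_le.1 (le_refl |μ|)
  unfold starLift
  rw [abs_le]
  split_ifs <;> constructor <;> nlinarith

end Lift

/-- The fair game has expected payoff `0`. -/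
theorem matBdot_half_mulVec_one (N : ℕ) : matBdot N (fun _ => 1 / 2) *ᵥ 1 = 0 := by
  funext x
  rw [matBdot, formMatrix_mulVec, Finset.sum_eq_zero fun i _ => ?_, mul_zero, Pi.zero_apply]
  split_ifs <;> norm_num

theorem profit_eq_sum_range {Ω : Type*} {N : ℕ} (X : ℕ → Ω → Config N × Fin N) (n : ℕ) (ω : Ω) :
    profit X n ω = ∑ k ∈ Finset.range n, payoff (X k ω) (X (k + 1) ω) := by
  unfold profit
  induction n with
  | zero => simp
  | succ n ih => rw [Finset.sum_range_succ, ← ih, Finset.sum_Icc_succ_top (by omega),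
      Nat.add_sub_cancel]

/-- The stationary mean of the expected profit over one period. -/
theorem dotProduct_eq_reducedMean {N : ℕ} {G : Subgroup (Equiv.Perm (Fin N))} {p : Fin 4 → ℝ}
    {r s : ℕ} (hr : 1 ≤ r) (π : Classes G → ℝ) :
    π ⬝ᵥ (∑ v ∈ Finset.range s,
      reduce G (matA N) ^ r *ᵥ (reduce G (matB N p) ^ v *ᵥ (reduce G (matBdot N p) *ᵥ 1)))
      = ((r : ℝ) + s) * reducedMean G p r s π := by
  have h0 : (r : ℝ) + s ≠ 0 := by positivity
  unfold reducedMean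
  rw [← mul_assoc, mul_one_div_cancel h0, one_mul, dotProduct_sum]
  refine Finset.sum_congr rfl fun v _ => ?_
  rw [← Matrix.dotProduct_mulVec, Matrix.mulVec_mulVec, Matrix.mulVec_mulVec]
  rfl

end Toral

theorem mainTheorem1 (N r s : ℕ) (hN : 3 ≤ N) (hr : 1 ≤ r) (hs : 1 ≤ s)
    (p : Fin 4 → ℝ) (hp : ∀ m, 0 < p m ∧ p m < 1)
    (G : Subgroup (Equiv.Perm (Fin N)))
    (hG : G = Toral.rotationGroup N ∨ (p 1 = p 2 ∧ G = Toral.dihedralGroup N)) :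
    ∃ π : Toral.Classes G → ℝ,
      Toral.IsStationary
        (Toral.reduce G (Toral.matA N) ^ r * Toral.reduce G (Toral.matB N p) ^ s) π ∧
      (∀ π' : Toral.Classes G → ℝ,
        Toral.IsStationary
          (Toral.reduce G (Toral.matA N) ^ r * Toral.reduce G (Toral.matB N p) ^ s) π' →
        π' = π) ∧
      ∀ {Ω : Type*} [MeasurableSpace Ω] (ℙ : Measure Ω) [IsProbabilityMeasure ℙ]
        (X : ℕ → Ω → Toral.Config N × Fin N),
        Toral.IsMarkovChain ℙ (Toral.pattern N p r s) X →
        ∀ᵐ ω ∂ℙ, Tendsto (fun n : ℕ => (n : ℝ)⁻¹ * Toral.profit X n ω) atTop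
          (𝓝 (Toral.reducedMean G p r s π)) := by
  open Toral in
    have hN0 : 0 < N := by omega
    have hhalf : ∀ m : Fin 4, 0 < (fun _ => 1 / 2 : Fin 4 → ℝ) m ∧
        (fun _ => 1 / 2 : Fin 4 → ℝ) m < 1 := fun _ => by norm_num
    have hG' : G = rotationGroup N ∨ G = dihedralGroup N := hG.imp_right And.right
    have hinvA : IsInvariant G (matB N fun _ => 1 / 2) :=
      isInvariant_formMatrix (hG'.imp_right fun h => ⟨h, rfl, rfl⟩)
    have hinvA' : IsInvariant G (matBdot N fun _ => 1 / 2) :=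
      isInvariant_formMatrix (hG'.imp_right fun h => ⟨h, rfl, rfl⟩)
    have hinvB : IsInvariant G (matB N p) :=
      isInvariant_formMatrix (hG.imp_right fun h => ⟨h.2, h.1, by simp only [h.1]⟩)
    have hinvB' : IsInvariant G (matBdot N p) :=
      isInvariant_formMatrix (hG.imp_right fun h => ⟨h.2, h.1, by simp only [h.1]⟩)
    have hA : reduce G (matA N) ∈ Matrix.rowStochastic ℝ (Classes G) :=
      reduce_matB_mem_rowStochastic hN0 hhalf hinvA
    have hB := reduce_matB_mem_rowStochastic hN0 hp hinvB
    have hrefl : ∀ a, ClassAdj G a a := fun a => Or.inl rfl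
    have hR := mul_mem (pow_mem hA r) (pow_mem hB s)
    have hconst : ∀ h : Classes G → ℝ,
        (reduce G (matA N) ^ r * reduce G (matB N p) ^ s) *ᵥ h = h → ∀ a b, h a = h b := fun h hh =>
      eq_of_mulVec_eq_self hR
        (mul_pos_of_pos hrefl (pow_mem hA r).1 (pow_mem hB s).1
          (pow_pos_of_pos hrefl hA (reduce_matB_pos hN0 hhalf hinvA) hr)
          (pow_pos_of_pos hrefl hB (reduce_matB_pos hN0 hp hinvB) hs))
        reflTransGen_classAdj hh
    have : Nonempty (Classes G) := ⟨cls G fun _ => false⟩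
    obtain ⟨π, hπ⟩ := exists_isStationary hR
    refine ⟨π, hπ, fun π' hπ' => IsStationary.eq_of_const hconst hπ hπ', ?_⟩
    intro Ω _ ℙ _ X hX
    obtain ⟨h, hh⟩ := exists_sub_mulVec_eq hπ hconst (∑ v ∈ Finset.range s,
        reduce G (matA N) ^ r *ᵥ (reduce G (matB N p) ^ v *ᵥ (reduce G (matBdot N p) *ᵥ 1)))
    rw [dotProduct_eq_reducedMean hr] at hh
    set μ := reducedMean G p r s π
    have hone : (fun _ : Classes G => ((r : ℝ) + s) * μ) = (((r : ℝ) + s) * μ) • 1 := by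
      funext a; simp
    rw [hone] at hh
    obtain ⟨H, ⟨C, hC⟩, hH⟩ := exists_periodic_poisson hA.2 hB.2 hs hh
    -- `P_A` is treated as the matrix `P_B` with all probabilities `1/2`.
    let pp : ℕ → Fin 4 → ℝ := fun n => if n % (r + s) < r then fun _ => 1 / 2 else p
    have hpp : ∀ n m, 0 < pp n m ∧ pp n m < 1 := fun n => by
      simp only [pp]; split_ifs; exacts [hhalf, hp]
    have hpat : ∀ n, pattern N p r s n = starB N (pp n) := fun n => by
      simp only [pattern, pp]; split_ifs <;> rfl
    have havg : ∀ n y, (N : ℝ)⁻¹ * ∑ j, starLift (pp n) μ (H (n + 1)) (y, j) = H n (cls G y) := by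
      intro n y
      rw [hH n]
      simp only [pp]
      split_ifs
      · rw [inv_mul_sum_starLift hN0 hinvA hinvA']
        have h0 : reduce G (matBdot N fun _ => 1 / 2) *ᵥ 1 = 0 := by
          funext a
          rw [← cls_rep a, reduce_mulVec hinvA']
          exact congrFun (matBdot_half_mulVec_one N) _
        rw [h0, zero_add]
        rfl
      · exact inv_mul_sum_starLift hN0 hinvB hinvB' _ _ _
    simp only [profit_eq_sum_range]
    refine hX.ae_tendsto_inv_mul_sum (u := fun n => starLift (pp n) μ (H (n + 1)))
      (fun n z => abs_starLift_le (hpp n) (hC (n + 1)) z) fun n z => ?_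
    rw [hpat n]
    exact sum_starB_payoff hN0 (havg (n + 1)) z
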